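/- For an integer partition $\lambda=(\lambda_1\ge\dots\ge\lambda_r>0)$ let $F_\lambda$ be the number of directed paths from $\emptyset$ to $\lambda$ in the Young lattice (each step adds one box), and let $n_i=\lambda_i+r-i$ for $1\le i\le r$. Let $L_n^{(\alpha)}$ be the Laguerre polynomials, given by $L_0^{(\alpha)}(x)=1$, $L_1^{(\alpha)}(x)=-x+\alpha+1$ and $$L_n^{(\alpha)}(x)=\Bigl(2+\frac{-x+\alpha-1}{n}\Bigr)L_{n-1}^{(\alpha)}(x)-\Bigl(1+\frac{\alpha-1}{n}\Bigr)L_{n-2}^{(\alpha)}(x)\qquad(n\ge 2),$$ let $l_n^{(\alpha)}(x)=n!\,L_n^{(\alpha-n)}(-x)$ be the modified Laguerre polynomials, and define the Wronskian Laguerre polynomials by $$l_\lambda^{(\alpha)}=\frac{\operatorname{Wr}\bigl[l_{n_1}^{(\alpha)},\dots,l_{n_r}^{(\alpha)}\bigr]}{\prod_{i<j}(n_j-n_i)},\qquad l_\emptyset^{(\alpha)}=1.$$ Then for every field $K$ of characteristic zero (for instance $\mathbb{R}$ or $\mathbb{C}$), every $\alpha\in K$ and every integer $n\ge 0$, the average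 of the Wronskian Laguerre polynomials of degree $n$ with respect to the Plancherel measure is $(x+\alpha)^n$; that is, as polynomials in $x$ over $K$, $$\sum_{\lambda\vdash n}\frac{F_\lambda^2}{n!}\,l_\lambda^{(\alpha)}(x)=(x+\alpha)^n.$$ -/

import Mathlib

open Polynomial

noncomputable section

namespace WronskianLaguerre

/-- The Young diagrams with `n` boxes form a finite set. -/
theorem finite_size (n : ℕ) : {lam : YoungDiagram | lam.card = n}.Finite := by
  have hinj : Function.Injective YoungDiagram.cells := fun a b h => YoungDiagram.ext h
  refine Set.Finite.of_injOn (f := YoungDiagram.cells)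
    (t := ((Finset.range n ×ˢ Finset.range n).powerset : Set (Finset (ℕ × ℕ)))) ?_
    hinj.injOn (Finset.finite_toSet _)
  intro lam h
  have h' : lam.cells.card = n := h
  simp only [Finset.coe_powerset, Set.mem_preimage, Set.mem_powerset_iff, Finset.coe_subset]
  rintro ⟨i, j⟩ hij
  have hmem : (i, j) ∈ lam := hij
  have hc : ((Finset.range (i + 1)).image fun k => (k, j)) ⊆ lam.cells := by
    intro c hc
    obtain ⟨k, hk, rfl⟩ := Finset.mem_image.1 hc
    exact lam.up_left_mem (Nat.lt_succ_iff.1 (Finset.mem_range.1 hk)) le_rfl hmem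
  have hr : ((Finset.range (j + 1)).image fun k => (i, k)) ⊆ lam.cells := by
    intro c hc
    obtain ⟨k, hk, rfl⟩ := Finset.mem_image.1 hc
    exact lam.up_left_mem le_rfl (Nat.lt_succ_iff.1 (Finset.mem_range.1 hk)) hmem
  have h1 := Finset.card_le_card hc
  have h2 := Finset.card_le_card hr
  rw [Finset.card_image_of_injective _ (fun a b h => (Prod.mk.inj h).1), Finset.card_range] at h1
  rw [Finset.card_image_of_injective _ (fun a b h => (Prod.mk.inj h).2), Finset.card_range] at h2
  simp only [Finset.mem_product, Finset.mem_range]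
  omega

/-- The finite set of all partitions `λ ⊢ n`, a partition being identified with its Young
diagram. -/
def partitionsOf (n : ℕ) : Finset YoungDiagram := (finite_size n).toFinset

theorem mem_partitionsOf {n : ℕ} {lam : YoungDiagram} :
    lam ∈ partitionsOf n ↔ lam.card = n := by
  simp [partitionsOf]

/-- `μ ⋖ λ` in the Young lattice: the diagram of `μ` is contained in that of `λ`, and
`|λ / μ| = 1`. -/
def AddsBox (mu lam : YoungDiagram) : Prop := mu ≤ lam ∧ lam.card = mu.card + 1

/-- The directed paths `∅ = p 0 ⋖ p 1 ⋖ ⋯ ⋖ p |λ| = λ` in the Young lattice. As every step adds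
exactly one box, every directed path from `∅` to `λ` has `|λ|` steps. -/
def paths (lam : YoungDiagram) : Set (Fin (lam.card + 1) → YoungDiagram) :=
  {p | p 0 = ⊥ ∧ p (Fin.last lam.card) = lam ∧
    ∀ i : Fin lam.card, AddsBox (p i.castSucc) (p i.succ)}

theorem finite_paths (lam : YoungDiagram) : (paths lam).Finite := by
  refine (Set.Finite.pi' fun i : Fin (lam.card + 1) => finite_size (i : ℕ)).subset ?_
  rintro p ⟨h0, -, hs⟩ i
  induction i using Fin.induction with
  | zero => simp [h0]
  | succ i ih =>
    have h1 := (hs i).2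
    simp only [Set.mem_ofPred_eq, Fin.val_castSucc, Fin.val_succ] at ih ⊢
    omega

/-- `F_λ`, the number of directed paths in the Young lattice from `∅` to `λ`. -/
def numPaths (lam : YoungDiagram) : ℕ := (paths lam).ncard

/-- The length `ℓ(λ)`: the number of (nonempty) rows. -/
def length (lam : YoungDiagram) : ℕ := lam.colLen 0

/-- The degree vector `n_i = λ_i + r - i`, `1 ≤ i ≤ r = ℓ(λ)`, with `i` running over
`0, …, r - 1` here (so that the subtraction never truncates). -/
def degVec (lam : YoungDiagram) (i : Fin (length lam)) : ℕ :=
  lam.rowLen i + (length lam - 1 - i)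

variable {K : Type*} [Field K]

/-- The Laguerre polynomials `L_n^{(α)}`. -/
def laguerre (α : K) : ℕ → K[X]
  | 0 => 1
  | 1 => -X + C (α + 1)
  | n + 2 =>
    (2 + C (((n : K) + 2)⁻¹) * (-X + C (α - 1))) * laguerre α (n + 1)
      - C (1 + (α - 1) / ((n : K) + 2)) * laguerre α n

/-- The modified Laguerre polynomials `l_n^{(α)}(x) = n! L_n^{(α - n)}(-x)`. -/
def modLaguerre (α : K) (n : ℕ) : K[X] :=
  C (n.factorial : K) * (laguerre (α - (n : K)) n).comp (-X)

/-- The Wronskian of finitely many polynomials: the determinant of the matrix whose row `i`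
(counted from `0`) consists of the `i`-th derivatives. -/
def wr {r : ℕ} (f : Fin r → K[X]) : K[X] :=
  (Matrix.of fun i j : Fin r => derivative^[(i : ℕ)] (f j)).det

/-- The Wronskian Laguerre polynomial
`l_λ^{(α)} = Wr[l_{n_1}^{(α)}, …, l_{n_r}^{(α)}] / ∏_{i < j} (n_j - n_i)`. -/
def wronskianLaguerre (α : K) (lam : YoungDiagram) : K[X] :=
  C (∏ i : Fin (length lam), ∏ j ∈ Finset.Ioi i, ((degVec lam j : K) - (degVec lam i : K)))⁻¹
    * wr fun i => modLaguerre α (degVec lam i)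

end WronskianLaguerre

end

/-! Both the Wronskian Laguerre polynomials and the path counts are specialized Schur functions,
given by Jacobi–Trudi determinants `schur h lam`. For h_k = l_k / k! (zero for k < 0) one has h_k' =
h_{k-1}, so the Wronskian is, up to factorials and a sign, the Schur function of this h
(`wr_modLaguerre`). The Vandermonde denominator is, with the same factorials and the same sign, the
Schur function at k ↦ 1/k! (`prod_degVec_sub`), and the latter equals F_λ / n!
(`numPaths_eq_factorial_mul_schur`). Hence F_λ l_λ = n! s_λ(h).

The claim thus reduces to ∑ F_λ s_λ(h) = h_1^n (`sum_numPaths_mul_schur`), which is Pieri's rule for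
h_1 iterated n times, since h_1 = x + α. -/

noncomputable section

namespace WronskianLaguerre

/-! ### Jacobi–Trudi determinants: raising and lowering one row -/

section JacobiTrudi

variable {A : Type*} [CommRing A]

/-- Expanding along the replaced row or column turns both sides into the trace of `M.adjugate * B`.
It converts changes of rows, which are changes of the partition, into changes of columns, which are
easy to evaluate. -/
theorem sum_det_updateRow {n : Type*} [Fintype n] [DecidableEq n] (M B : Matrix n n A) :
    ∑ i, (M.updateRow i (B i)).det = ∑ j, (M.updateCol j fun i => B i j).det := by
  have hrow (i : n) : (M.updateRow i (B i)).det = ∑ j, M.adjugate j i * B i j := by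
    rw [← Matrix.cramer_transpose_apply, Matrix.cramer_eq_adjugate_mulVec,
      ← Matrix.adjugate_transpose]
    rfl
  have hcol (j : n) : (M.updateCol j fun i => B i j).det = ∑ i, M.adjugate j i * B i j := by
    rw [← Matrix.cramer_apply, Matrix.cramer_eq_adjugate_mulVec]
    rfl
  simp only [hrow, hcol]
  exact Finset.sum_comm

theorem det_eq_of_last_row {R : ℕ} (M : Matrix (Fin (R + 1)) (Fin (R + 1)) A)
    (hM : ∀ j : Fin R, M (Fin.last R) j.castSucc = 0) :
    M.det = M (Fin.last R) (Fin.last R) * (M.submatrix Fin.castSucc Fin.castSucc).det := by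
  rw [Matrix.det_succ_row M (Fin.last R), Fin.sum_univ_castSucc]
  simp [hM, Fin.succAbove_last, ← two_mul]

/-- The Jacobi–Trudi determinant `det (h_{a_i + j - i})` of size `R`. -/
def jacobiTrudi (h : ℤ → A) (R : ℕ) (a : ℕ → ℤ) : A :=
  (Matrix.of fun i j : Fin R => h (a i + j - i)).det

theorem jacobiTrudi_succ {h : ℤ → A} (hneg : ∀ k < 0, h k = 0) (h0 : h 0 = 1) {R : ℕ}
    {a : ℕ → ℤ} (ha : a R = 0) : jacobiTrudi h (R + 1) a = jacobiTrudi h R a := by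
  rw [jacobiTrudi, det_eq_of_last_row]
  · simp [ha, h0, jacobiTrudi, Matrix.submatrix]
  · intro j
    simp only [Matrix.of_apply, Fin.val_last, ha, Fin.val_castSucc]
    exact hneg _ (by have := j.2; omega)

theorem jacobiTrudi_eq_zero_of_adjacent (h : ℤ → A) {R k : ℕ} {a : ℕ → ℤ} (hk : k + 1 < R)
    (ha : a (k + 1) = a k + 1) : jacobiTrudi h R a = 0 := by
  refine Matrix.det_zero_of_row_eq (i := ⟨k, by omega⟩) (j := ⟨k + 1, hk⟩) (by simp) ?_
  ext j
  simp only [Matrix.of_apply, ha]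
  congr 1
  push_cast
  ring

theorem jacobiTrudi_eq_zero_of_last_neg {h : ℤ → A} (hneg : ∀ k < 0, h k = 0) {R : ℕ}
    {a : ℕ → ℤ} (ha : a R < 0) : jacobiTrudi h (R + 1) a = 0 := by
  refine Matrix.det_eq_zero_of_row_eq_zero (Fin.last R) fun j => ?_
  simp only [Matrix.of_apply, Fin.val_last]
  exact hneg _ (by have := j.2; omega)

theorem jacobiTrudi_update (h : ℤ → A) {R : ℕ} (a : ℕ → ℤ) (i : Fin R) (b : ℤ) :
    jacobiTrudi h R (Function.update a i b) =
      ((Matrix.of fun i j : Fin R => h (a i + j - i)).updateRow i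
        fun j => h (b + j - i)).det := by
  rw [jacobiTrudi]
  congr 1
  ext k j
  by_cases hk : k = i
  · subst hk; simp
  · have : (k : ℕ) ≠ i := fun e => hk (Fin.ext e)
    simp [Matrix.updateRow_ne hk, Function.update_of_ne this]

/-- Pieri's rule for multiplication by `h 1`. -/
theorem sum_jacobiTrudi_raise {h : ℤ → A} (hneg : ∀ k < 0, h k = 0) {R : ℕ}
    {a : ℕ → ℤ} (ha : a R = 0) :
    ∑ i : Fin (R + 1), jacobiTrudi h (R + 1) (Function.update a i (a i + 1)) =
      h 1 * jacobiTrudi h R a := by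
  simp only [jacobiTrudi_update]
  refine (sum_det_updateRow _
    (Matrix.of fun i j : Fin (R + 1) => h (a i + 1 + j - i))).trans ?_
  -- Raising every row index by one shifts the columns: column j is replaced by a copy of column j +
  -- 1. Only the last column has no such duplicate.
  rw [Fin.sum_univ_castSucc, Finset.sum_eq_zero, zero_add]
  · rw [det_eq_of_last_row]
    · congr 1
      · simp [ha]
      · rw [jacobiTrudi]
        congr 1
        ext i j
        simp
    · intro j
      rw [Matrix.updateCol_ne (Fin.castSucc_lt_last j).ne]
      simp only [Matrix.of_apply, Fin.val_last, ha, Fin.val_castSucc]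
      exact hneg _ (by have := j.2; omega)
  · intro j _
    have hj : j.succ ≠ j.castSucc := (Fin.castSucc_lt_succ).ne'
    refine Matrix.det_zero_of_column_eq hj fun i => ?_
    rw [Matrix.updateCol_ne hj, Matrix.updateCol_self]
    simp only [Matrix.of_apply, Fin.val_succ, Fin.val_castSucc]
    congr 1
    push_cast
    ring

/-- By `hh`, lowering row i multiplies its entry in column j by a_i + j - i. The part a_i - i is a
scalar on the row; the part j becomes, via `sum_det_updateRow`, a scalar on column j. Summed up, the
i's and j's cancel. -/
theorem sum_jacobiTrudi_lower {h : ℤ → A} (hh : ∀ k : ℤ, (k : A) * h k = h (k - 1)) (R : ℕ)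
    (a : ℕ → ℤ) :
    ∑ i : Fin R, jacobiTrudi h R (Function.update a i (a i - 1)) =
      ((∑ i : Fin R, a i : ℤ) : A) * jacobiTrudi h R a := by
  simp only [jacobiTrudi_update]
  set M : Matrix (Fin R) (Fin R) A := Matrix.of fun i j => h (a i + j - i) with hM
  have key (i : Fin R) : (M.updateRow i fun j => h (a i - 1 + j - i)).det =
      (a i - i : A) * M.det +
        (M.updateRow i ((Matrix.of fun i j : Fin R => (j : A) * M i j) i)).det := by
    have : (fun j : Fin R => h (a i - 1 + j - i)) = (a i - i : A) • M i +
        (Matrix.of fun i j : Fin R => (j : A) * M i j) i := by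
      ext j
      have := hh (a i + j - i)
      simp only [Pi.add_apply, Pi.smul_apply, Matrix.of_apply, smul_eq_mul, hM]
      rw [show a i - 1 + (j : ℤ) - i = a i + j - i - 1 by ring, ← this]
      push_cast
      ring
    rw [this, Matrix.det_updateRow_add, Matrix.det_updateRow_smul, Matrix.updateRow_eq_self]
  have hcol (j : Fin R) : (M.updateCol j fun i =>
      (Matrix.of fun i j : Fin R => (j : A) * M i j) i j).det = (j : A) * M.det := by
    have : (fun i => (Matrix.of fun i j : Fin R => (j : A) * M i j) i j) =
        (j : A) • fun i => M i j := by
      ext i; simp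
    rw [this, Matrix.det_updateCol_smul, Matrix.updateCol_eq_self]
  simp only [key]
  rw [Finset.sum_add_distrib, sum_det_updateRow]
  simp only [hcol, ← Finset.sum_mul]
  rw [← add_mul, Finset.sum_sub_distrib, sub_add_cancel, jacobiTrudi, ← hM]
  push_cast
  rfl

end JacobiTrudi

/-! ### Modified Laguerre polynomials as an Appell sequence -/

variable {K : Type*} [Field K]

theorem C_mul_cancel {a : K} (ha : a ≠ 0) {p q : K[X]} (h : C a * p = C a * q) : p = q :=
  mul_left_cancel₀ (C_ne_zero.2 ha) h

/-- The normalized modified Laguerre polynomials `l_k^{(α)} / k!`, vanishing for `k < 0`. -/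
def normLaguerre (α : K) : ℤ → K[X]
  | Int.ofNat k => (laguerre (α - (k : K)) k).comp (-X)
  | Int.negSucc _ => 0

theorem normLaguerre_natCast (α : K) (k : ℕ) :
    normLaguerre α k = (laguerre (α - (k : K)) k).comp (-X) := rfl

theorem normLaguerre_of_neg (α : K) {k : ℤ} (hk : k < 0) : normLaguerre α k = 0 := by
  obtain ⟨m, rfl⟩ := Int.eq_negSucc_of_lt_zero hk
  rfl

theorem normLaguerre_zero (α : K) : normLaguerre α 0 = 1 := by
  simpa [laguerre] using normLaguerre_natCast α 0

theorem normLaguerre_one (α : K) : normLaguerre α 1 = X + C α := by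
  simpa [laguerre] using normLaguerre_natCast α 1

section Laguerre

variable [CharZero K]

theorem laguerre_recurrence (α : K) (n : ℕ) :
    C ((n : K) + 2) * laguerre α (n + 2) =
      (C (2 * (n : K) + 3 + α) - X) * laguerre α (n + 1) - C ((n : K) + 1 + α) * laguerre α n := by
  have hn : ((n : K) + 2) ≠ 0 := by exact_mod_cast (by omega : n + 2 ≠ 0)
  have h1 : C ((n : K) + 2) * (2 + C (((n : K) + 2)⁻¹) * (-X + C (α - 1))) =
      C (2 * (n : K) + 3 + α) - X := by
    rw [mul_add, ← mul_assoc, ← C_mul, mul_inv_cancel₀ hn]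
    simp only [map_add, map_sub, map_mul, map_ofNat, map_one, map_natCast]
    ring
  have h2 : C ((n : K) + 2) * C (1 + (α - 1) / ((n : K) + 2)) = C ((n : K) + 1 + α) := by
    rw [← C_mul]
    congr 1
    field_simp
    ring
  rw [laguerre, mul_sub, ← mul_assoc, ← mul_assoc, h1, h2]

/-- Contiguity in α, needed to close the induction for the derivative, which itself shifts α. -/
theorem laguerre_succ_eq_sub (α : K) (n : ℕ) :
    laguerre α (n + 1) = laguerre (α + 1) (n + 1) - laguerre (α + 1) n := by
  induction n using Nat.strong_induction_on with
  | _ n ih =>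
    match n with
    | 0 =>
      simp only [laguerre, map_add, map_one]
      ring
    | 1 =>
      refine C_mul_cancel (a := (2 : K)) two_ne_zero ?_
      have h1 := laguerre_recurrence α 0
      have h2 := laguerre_recurrence (α + 1) 0
      simp only [laguerre, Nat.cast_zero, zero_add, map_add, map_one, map_mul, map_ofNat,
        map_zero] at h1 h2 ⊢
      linear_combination h1 - h2
    | n + 2 =>
      have hn : ((n : K) + 3) ≠ 0 := by exact_mod_cast (by omega : n + 3 ≠ 0)
      refine C_mul_cancel hn ?_
      have h1 := laguerre_recurrence α (n + 1)
      have h2 := laguerre_recurrence (α + 1) (n + 1)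
      have h3 := laguerre_recurrence (α + 1) n
      rw [ih (n + 1) (by omega), ih n (by omega)] at h1
      simp only [Nat.cast_add, Nat.cast_one, map_add, map_one, map_mul, map_ofNat,
        map_natCast] at h1 h2 h3 ⊢
      linear_combination h1 - h2 + h3

theorem derivative_laguerre (α : K) (n : ℕ) :
    derivative (laguerre α (n + 1)) = -laguerre (α + 1) n := by
  induction n using Nat.strong_induction_on with
  | _ n ih =>
    match n with
    | 0 => simp [laguerre]
    | 1 =>
      refine C_mul_cancel (a := (2 : K)) two_ne_zero ?_
      have h1 := congrArg derivative (laguerre_recurrence α 0)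
      simp only [laguerre, Nat.cast_zero, zero_add, derivative_mul, derivative_sub, derivative_C,
        derivative_X, derivative_neg, map_add, map_one, map_mul, map_ofNat,
        map_zero, derivative_ofNat, derivative_one] at h1 ⊢
      linear_combination h1
    | n + 2 =>
      have hn : ((n : K) + 3) ≠ 0 := by exact_mod_cast (by omega : n + 3 ≠ 0)
      refine C_mul_cancel hn ?_
      have h1 := congrArg derivative (laguerre_recurrence α (n + 1))
      have h3 := laguerre_recurrence (α + 1) n
      have h4 := laguerre_succ_eq_sub α (n + 1)
      rw [derivative_C_mul, derivative_sub, derivative_C_mul, derivative_mul,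
        ih (n + 1) (by omega), ih n (by omega), h4, derivative_sub, derivative_C,
        derivative_X] at h1
      simp only [Nat.cast_add, Nat.cast_one, map_add,
        map_one, map_mul, map_ofNat, map_natCast] at h1 h3 ⊢
      linear_combination h1 + h3

/-- Differentiation raises the Laguerre parameter by one and lowers the degree by one, so α - k
becomes α - (k - 1); the argument -x absorbs the sign. -/
theorem derivative_normLaguerre (α : K) (k : ℤ) :
    derivative (normLaguerre α k) = normLaguerre α (k - 1) := by
  rcases lt_or_ge k 0 with hk | hk
  · rw [normLaguerre_of_neg α hk, normLaguerre_of_neg α (by omega), derivative_zero]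
  · lift k to ℕ using hk
    match k with
    | 0 => simp [normLaguerre_zero, normLaguerre_of_neg]
    | k + 1 =>
      rw [show ((k + 1 : ℕ) : ℤ) - 1 = (k : ℕ) by push_cast; ring, normLaguerre_natCast,
        normLaguerre_natCast, derivative_comp, derivative_laguerre]
      simp [show α - ((k : K) + 1) + 1 = α - k by ring]

theorem iterate_derivative_normLaguerre (α : K) (k : ℤ) (i : ℕ) :
    derivative^[i] (normLaguerre α k) = normLaguerre α (k - i) := by
  induction i with
  | zero => simp
  | succ i ih =>
    rw [Function.iterate_succ_apply', ih, derivative_normLaguerre]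
    congr 1
    push_cast
    ring

theorem iterate_derivative_modLaguerre (α : K) (n i : ℕ) :
    derivative^[i] (modLaguerre α n) = C (n.factorial : K) * normLaguerre α (n - i) := by
  rw [modLaguerre, iterate_derivative_C_mul, ← normLaguerre_natCast,
    iterate_derivative_normLaguerre]

end Laguerre

/-! ### The exponential specialization -/

/-- The sequence `k ↦ 1 / k!`, vanishing for `k < 0`. -/
def invFactorial (K : Type*) [Field K] : ℤ → K
  | Int.ofNat k => (k.factorial : K)⁻¹
  | Int.negSucc _ => 0

theorem invFactorial_natCast (k : ℕ) : invFactorial K k = (k.factorial : K)⁻¹ := rfl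

theorem invFactorial_of_neg {k : ℤ} (hk : k < 0) : invFactorial K k = 0 := by
  obtain ⟨m, rfl⟩ := Int.eq_negSucc_of_lt_zero hk
  rfl

theorem invFactorial_zero : invFactorial K 0 = 1 := by
  simpa using invFactorial_natCast (K := K) 0

theorem mul_invFactorial [CharZero K] (k : ℤ) :
    (k : K) * invFactorial K k = invFactorial K (k - 1) := by
  rcases lt_or_ge k 0 with hk | hk
  · rw [invFactorial_of_neg hk, invFactorial_of_neg (by omega), mul_zero]
  · lift k to ℕ using hk
    match k with
    | 0 => simp [invFactorial_of_neg]
    | k + 1 =>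
      have hk : ((k : K) + 1) ≠ 0 := by exact_mod_cast k.succ_ne_zero
      rw [show ((k + 1 : ℕ) : ℤ) - 1 = (k : ℕ) by push_cast; ring, invFactorial_natCast,
        invFactorial_natCast, Nat.factorial_succ]
      push_cast
      rw [mul_inv, mul_inv_cancel_left₀ hk]

theorem factorial_mul_invFactorial_sub [CharZero K] (n i : ℕ) :
    (n.factorial : K) * invFactorial K (n - i) = (n.descFactorial i : K) := by
  rcases lt_or_ge n i with h | h
  · rw [invFactorial_of_neg (by omega), Nat.descFactorial_of_lt h]
    simp
  · rw [← Nat.cast_sub h, invFactorial_natCast, ← Nat.factorial_mul_descFactorial h]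
    have : ((n - i).factorial : K) ≠ 0 := by exact_mod_cast Nat.factorial_ne_zero _
    push_cast
    field_simp

/-! ### Adding a box in the Young lattice, and counting paths -/

section Young

theorem addsBox_iff {mu lam : YoungDiagram} :
    AddsBox mu lam ↔ ∃ i, lam.cells = insert (i, mu.rowLen i) mu.cells := by
  have hnot (i : ℕ) : (i, mu.rowLen i) ∉ mu.cells := by
    rw [YoungDiagram.mem_cells, YoungDiagram.mem_iff_lt_rowLen]
    exact lt_irrefl _
  constructor
  · rintro ⟨hle, hcard⟩
    have hsub := YoungDiagram.cells_subset_iff.2 hle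
    have h1 : (lam.cells \ mu.cells).card = 1 := by
      rw [Finset.card_sdiff_of_subset hsub]
      change lam.card - mu.card = 1
      omega
    obtain ⟨⟨i, j⟩, hc⟩ := Finset.card_eq_one.1 h1
    have hmem : (i, j) ∈ lam.cells \ mu.cells := by simp [hc]
    rw [Finset.mem_sdiff, YoungDiagram.mem_cells, YoungDiagram.mem_cells,
      YoungDiagram.mem_iff_lt_rowLen (μ := mu), not_lt] at hmem
    -- The first cell of row i outside `mu` also lies in the one-element difference, so it is the
    -- added box.
    have h2 : (i, mu.rowLen i) ∈ lam.cells \ mu.cells :=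
      Finset.mem_sdiff.2 ⟨lam.up_left_mem le_rfl hmem.2 hmem.1, hnot i⟩
    rw [hc, Finset.mem_singleton] at h2
    refine ⟨i, ?_⟩
    rw [h2, Finset.insert_eq, ← hc, Finset.sdiff_union_of_subset hsub]
  · rintro ⟨i, hi⟩
    refine ⟨YoungDiagram.cells_subset_iff.1 (hi ▸ Finset.subset_insert _ _), ?_⟩
    change lam.cells.card = mu.cells.card + 1
    rw [hi, Finset.card_insert_of_notMem (hnot i)]

/-- The row lengths of a Young diagram, as integers. -/
def rows (lam : YoungDiagram) (k : ℕ) : ℤ := lam.rowLen k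

theorem rows_injective : Function.Injective rows := by
  intro a b h
  refine SetLike.ext fun ⟨i, j⟩ => ?_
  have : a.rowLen i = b.rowLen i := Nat.cast_injective (R := ℤ) (congrFun h i)
  rw [YoungDiagram.mem_iff_lt_rowLen, YoungDiagram.mem_iff_lt_rowLen, this]

theorem rows_of_cells_eq_insert {mu lam : YoungDiagram} {i : ℕ}
    (h : lam.cells = insert (i, mu.rowLen i) mu.cells) :
    rows lam = Function.update (rows mu) i (rows mu i + 1) := by
  have key (k : ℕ) : lam.rowLen k = if k = i then mu.rowLen i + 1 else mu.rowLen k := by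
    refine eq_of_forall_lt_iff fun j => ?_
    rw [← YoungDiagram.mem_iff_lt_rowLen, ← YoungDiagram.mem_cells, h, Finset.mem_insert,
      YoungDiagram.mem_cells, YoungDiagram.mem_iff_lt_rowLen, Prod.mk.injEq]
    split_ifs with hk
    · subst hk; omega
    · simp [hk]
  ext k
  by_cases hk : k = i
  · subst hk; simp [rows, key]
  · simp [rows, key, hk]

theorem AddsBox.exists_rows_eq {mu lam : YoungDiagram} (h : AddsBox mu lam) :
    ∃ i, rows lam = Function.update (rows mu) i (rows mu i + 1) :=
  (addsBox_iff.1 h).imp fun _ => rows_of_cells_eq_insert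

theorem exists_addsBox_raise {mu : YoungDiagram} {i : ℕ}
    (hi : ∀ k, i = k + 1 → mu.rowLen i < mu.rowLen k) :
    ∃ lam, AddsBox mu lam ∧ rows lam = Function.update (rows mu) i (rows mu i + 1) := by
  let lam : YoungDiagram :=
    { cells := insert (i, mu.rowLen i) mu.cells
      isLowerSet := by
        rintro ⟨a, b⟩ ⟨c, d⟩ hle hab
        obtain ⟨hca : c ≤ a, hdb : d ≤ b⟩ := hle
        simp only [Finset.coe_insert, Set.mem_insert_iff, Finset.mem_coe,
          YoungDiagram.mem_cells, Prod.mk.injEq] at hab ⊢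
        rcases hab with ⟨rfl, rfl⟩ | hab
        · rcases hca.eq_or_lt with rfl | hlt
          · rcases hdb.eq_or_lt with rfl | hlt
            · exact Or.inl ⟨rfl, rfl⟩
            · exact Or.inr (YoungDiagram.mem_iff_lt_rowLen.2 hlt)
          · obtain ⟨k, rfl⟩ : ∃ k, a = k + 1 := ⟨a - 1, by omega⟩
            refine Or.inr (YoungDiagram.mem_iff_lt_rowLen.2 ?_)
            exact (hdb.trans_lt (hi k rfl)).trans_le (mu.rowLen_anti _ _ (by omega))
        · exact Or.inr (mu.up_left_mem hca hdb hab) }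
  have hlam : lam.cells = insert (i, mu.rowLen i) mu.cells := rfl
  exact ⟨lam, addsBox_iff.2 ⟨i, hlam⟩, rows_of_cells_eq_insert hlam⟩

theorem exists_addsBox_lower {lam : YoungDiagram} {i : ℕ}
    (hi : lam.rowLen (i + 1) < lam.rowLen i) :
    ∃ mu, AddsBox mu lam ∧ rows mu = Function.update (rows lam) i (rows lam i - 1) := by
  have hmem : (i, lam.rowLen i - 1) ∈ lam.cells :=
    YoungDiagram.mem_iff_lt_rowLen.2 (by omega)
  let mu : YoungDiagram :=
    { cells := lam.cells.erase (i, lam.rowLen i - 1)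
      isLowerSet := by
        rintro ⟨a, b⟩ ⟨c, d⟩ hle hab
        obtain ⟨hca : c ≤ a, hdb : d ≤ b⟩ := hle
        simp only [Finset.coe_erase, Set.mem_sdiff, Finset.mem_coe,
          YoungDiagram.mem_cells, Set.mem_singleton_iff, Prod.mk.injEq] at hab ⊢
        refine ⟨lam.up_left_mem hca hdb hab.1, ?_⟩
        rintro ⟨rfl, rfl⟩
        have h1 := YoungDiagram.mem_iff_lt_rowLen.1 hab.1
        rcases hca.eq_or_lt with rfl | hlt
        · exact hab.2 ⟨rfl, by omega⟩
        · have := lam.rowLen_anti (c + 1) a hlt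
          omega }
  have hlen : mu.rowLen i = lam.rowLen i - 1 := by
    refine eq_of_forall_lt_iff fun j => ?_
    rw [← YoungDiagram.mem_iff_lt_rowLen, ← YoungDiagram.mem_cells]
    change (i, j) ∈ lam.cells.erase (i, lam.rowLen i - 1) ↔ _
    rw [Finset.mem_erase, YoungDiagram.mem_cells, YoungDiagram.mem_iff_lt_rowLen, Ne,
      Prod.mk.injEq]
    omega
  have hlam : lam.cells = insert (i, mu.rowLen i) mu.cells := by
    rw [hlen]
    exact (Finset.insert_erase hmem).symm
  refine ⟨mu, addsBox_iff.2 ⟨i, hlam⟩, ?_⟩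
  rw [rows_of_cells_eq_insert hlam]
  simp

theorem rowLen_eq_zero_iff {lam : YoungDiagram} {R : ℕ} :
    lam.rowLen R = 0 ↔ length lam ≤ R := by
  have h := (YoungDiagram.mem_iff_lt_rowLen (μ := lam) (i := R) (j := 0)).symm.trans
    YoungDiagram.mem_iff_lt_colLen
  rw [length]
  omega

theorem sum_rows {lam : YoungDiagram} {R : ℕ} (hR : length lam ≤ R) :
    ∑ i : Fin R, rows lam i = lam.card := by
  rw [Fin.sum_univ_eq_sum_range (rows lam), YoungDiagram.card,
    Finset.card_eq_sum_card_fiberwise (f := Prod.fst) (t := Finset.range R)]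
  · push_cast
    refine Finset.sum_congr rfl fun i _ => ?_
    rw [rows, YoungDiagram.rowLen_eq_card]
    rfl
  · rintro ⟨i, j⟩ hij
    have hij' := YoungDiagram.mem_iff_lt_rowLen.1 (YoungDiagram.mem_cells _ |>.1 hij)
    rw [Finset.mem_coe, Finset.mem_range]
    by_contra hlt
    have : lam.rowLen i = 0 := rowLen_eq_zero_iff.2 (hR.trans (not_lt.1 hlt))
    omega

/-- The chains `∅ = p 0 ⋖ ⋯ ⋖ p n = λ`. -/
def chains (n : ℕ) (lam : YoungDiagram) : Set (Fin (n + 1) → YoungDiagram) :=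
  {p | p 0 = ⊥ ∧ p (Fin.last n) = lam ∧ ∀ i : Fin n, AddsBox (p i.castSucc) (p i.succ)}

/-- Frees the length of a path from `lam.card`, so that the last step can be removed by induction.
-/
theorem numPaths_eq_ncard_chains {n : ℕ} {lam : YoungDiagram} (h : lam.card = n) :
    numPaths lam = (chains n lam).ncard := by
  subst h; rfl

theorem chains_succ (n : ℕ) (lam : YoungDiagram) :
    chains (n + 1) lam = ⋃ mu ∈ {mu | AddsBox mu lam},
      (fun q : Fin (n + 1) → YoungDiagram => (Fin.snoc q lam : Fin (n + 2) → YoungDiagram)) ''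
        chains n mu := by
  ext p
  simp only [Set.mem_iUnion, Set.mem_image, exists_prop]
  constructor
  · rintro ⟨h0, h1, hs⟩
    refine ⟨p (Fin.last n).castSucc, ?_, Fin.init p, ⟨h0, rfl, fun i => hs i.castSucc⟩, ?_⟩
    · have := hs (Fin.last n)
      rwa [Fin.succ_last, h1] at this
    · rw [← h1, Fin.snoc_init_self]
  · rintro ⟨mu, hmu, q, ⟨h0, h1, hs⟩, rfl⟩
    refine ⟨?_, Fin.snoc_last _ _, fun i => ?_⟩
    · rw [← Fin.castSucc_zero, Fin.snoc_castSucc, h0]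
    · induction i using Fin.lastCases with
      | last => rw [Fin.snoc_castSucc, Fin.succ_last, Fin.snoc_last, h1]; exact hmu
      | cast i => rw [Fin.snoc_castSucc, Fin.succ_castSucc, Fin.snoc_castSucc]; exact hs i

open Classical in
theorem numPaths_eq_sum {n : ℕ} {lam : YoungDiagram} (h : lam.card = n + 1) :
    numPaths lam = ∑ mu ∈ partitionsOf n with AddsBox mu lam, numPaths mu := by
  have hS : {mu | AddsBox mu lam} =
      (((partitionsOf n).filter fun mu => AddsBox mu lam : Finset YoungDiagram) :
        Set YoungDiagram) := by
    ext mu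
    simp only [Set.mem_ofPred_eq, Finset.coe_filter, mem_partitionsOf]
    refine ⟨fun hmu => ⟨?_, hmu⟩, fun hmu => hmu.2⟩
    have := hmu.2
    omega
  have hcard {mu} (hmu : mu ∈ (((partitionsOf n).filter fun mu => AddsBox mu lam :
      Finset YoungDiagram) : Set YoungDiagram)) : mu.card = n :=
    mem_partitionsOf.1 (Finset.mem_filter.1 hmu).1
  have hinj : Function.Injective (fun q : Fin (n + 1) → YoungDiagram =>
      (Fin.snoc q lam : Fin (n + 2) → YoungDiagram)) := fun a b hab => by
    simpa using congrArg Fin.init hab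
  rw [numPaths_eq_ncard_chains h, chains_succ, hS,
    (Finset.finite_toSet _).ncard_biUnion, finsum_mem_coe_finset]
  · refine Finset.sum_congr rfl fun mu hmu => ?_
    rw [Set.ncard_image_of_injective _ hinj, numPaths_eq_ncard_chains (hcard hmu)]
  · intro mu hmu
    refine Set.Finite.image _ ?_
    have := finite_paths mu
    rw [← hcard hmu]
    exact this
  · intro mu _ nu _ hne
    refine Set.disjoint_left.2 ?_
    rintro p ⟨q, ⟨-, hq, -⟩, rfl⟩ ⟨q', ⟨-, hq', -⟩, hqq⟩
    exact hne (hq.symm.trans ((congrFun (hinj hqq).symm _).trans hq'))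

theorem eq_bot_of_card_eq_zero {lam : YoungDiagram} (h : lam.card = 0) : lam = ⊥ :=
  YoungDiagram.ext (by rw [Finset.card_eq_zero.1 h, YoungDiagram.cells_bot])

theorem partitionsOf_zero : partitionsOf 0 = {⊥} := by
  ext lam
  rw [mem_partitionsOf, Finset.mem_singleton]
  refine ⟨eq_bot_of_card_eq_zero, ?_⟩
  rintro rfl
  simp

theorem numPaths_bot : numPaths ⊥ = 1 := by
  rw [numPaths_eq_ncard_chains (n := 0) (by simp), Set.ncard_eq_one]
  refine ⟨fun _ => ⊥, ?_⟩
  ext p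
  simp only [chains, Set.mem_ofPred_eq, Set.mem_singleton_iff]
  refine ⟨fun hp => funext fun i => ?_, fun hp => by subst hp; simp⟩
  rw [Fin.fin_one_eq_zero i, ← hp.1]

end Young

/-! ### Branching rules for specialized Schur functions -/

section Schur

variable {A : Type*} [CommRing A]

/-- The Schur function of `λ` specialized at the complete homogeneous values `h`. -/
def schur (h : ℤ → A) (lam : YoungDiagram) : A := jacobiTrudi h (length lam) (rows lam)

theorem schur_bot (h : ℤ → A) : schur h ⊥ = 1 := by
  have : length ⊥ = 0 := Nat.le_zero.1 <| rowLen_eq_zero_iff.1 <| by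
    by_contra hne
    exact YoungDiagram.notMem_bot (0, 0)
      (YoungDiagram.mem_iff_lt_rowLen.2 (Nat.pos_of_ne_zero hne))
  rw [schur, this, jacobiTrudi, Matrix.det_isEmpty]

variable {h : ℤ → A}

theorem jacobiTrudi_rows (hneg : ∀ k < 0, h k = 0) (h0 : h 0 = 1) {lam : YoungDiagram} {R : ℕ}
    (hR : length lam ≤ R) : jacobiTrudi h R (rows lam) = schur h lam := by
  induction R, hR using Nat.le_induction with
  | base => rfl
  | succ R hR ih =>
    rw [jacobiTrudi_succ hneg h0, ih]
    simp [rows, rowLen_eq_zero_iff.2 hR]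

theorem update_add_index_injective {a : ℕ → ℤ} {c : ℤ} (hc : c ≠ 0) {i j : ℕ}
    (h : Function.update a i (a i + c) = Function.update a j (a j + c)) : i = j := by
  by_contra hne
  have := congrFun h i
  rw [Function.update_self, Function.update_of_ne hne] at this
  omega

open Classical in
theorem sum_schur_raise (hneg : ∀ k < 0, h k = 0) (h0 : h 0 = 1) {n : ℕ} {mu : YoungDiagram}
    (hmu : mu.card = n) :
    ∑ lam ∈ partitionsOf (n + 1) with AddsBox mu lam, schur h lam = h 1 * schur h mu := by
  set R := length mu with hR
  have hlast : mu.rowLen R = 0 := rowLen_eq_zero_iff.2 le_rfl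
  have hadd (lam : YoungDiagram) (hl : AddsBox mu lam) := hl.exists_rows_eq
  choose! e he using hadd
  have hrow {lam} (hl : AddsBox mu lam) (k : ℕ) (hk : k ≠ e lam) :
      lam.rowLen k = mu.rowLen k := by
    have := congrFun (he lam hl) k
    rw [Function.update_of_ne hk] at this
    simp only [rows] at this
    exact_mod_cast this
  have hrow' {lam} (hl : AddsBox mu lam) : lam.rowLen (e lam) = mu.rowLen (e lam) + 1 := by
    have := congrFun (he lam hl) (e lam)
    rw [Function.update_self] at this
    simp only [rows] at this
    exact_mod_cast this
  have hle {lam} (hl : AddsBox mu lam) : e lam ≤ R := by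
    by_contra hlt
    have h1 := lam.rowLen_anti R (e lam) (by omega)
    have h2 := hrow hl R (by omega)
    have h3 := hrow' hl
    omega
  rw [schur, ← hR, ← sum_jacobiTrudi_raise hneg (by simp [rows, hlast]),
    Fin.sum_univ_eq_sum_range
      (fun i => jacobiTrudi h (R + 1) (Function.update (rows mu) i (rows mu i + 1)))]
  -- `e` sends a diagram to the row of its new box; row R, just below `mu`, is allowed. An index not
  -- reached is a row as long as the one above it, and its raised determinant has two equal rows.
  refine Finset.sum_of_injOn e ?_ ?_ ?_ ?_
  · intro a ha b hb hab
    have ha := (Finset.mem_filter.1 ha).2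
    have hb := (Finset.mem_filter.1 hb).2
    exact rows_injective (by rw [he a ha, he b hb, hab])
  · intro a ha
    have := hle (Finset.mem_filter.1 ha).2
    exact Finset.mem_range.2 (by omega)
  · intro i hi hni
    rw [Finset.mem_range] at hi
    by_cases hc : ∀ k, i = k + 1 → mu.rowLen i < mu.rowLen k
    · obtain ⟨lam, hl, hr⟩ := exists_addsBox_raise hc
      refine absurd ⟨lam, ?_, ?_⟩ hni
      · rw [Finset.coe_filter]
        refine ⟨mem_partitionsOf.2 ?_, hl⟩
        rw [hl.2, hmu]
      · exact update_add_index_injective one_ne_zero ((he lam hl).symm.trans hr)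
    · push Not at hc
      obtain ⟨k, rfl, hk⟩ := hc
      refine jacobiTrudi_eq_zero_of_adjacent h (k := k) hi ?_
      have := le_antisymm hk (mu.rowLen_anti k (k + 1) (by omega))
      simp [rows, this]
  · intro lam hl
    have hl := (Finset.mem_filter.1 hl).2
    rw [← he lam hl, jacobiTrudi_rows hneg h0]
    rw [← rowLen_eq_zero_iff, hrow hl _ (by have := hle hl; omega), rowLen_eq_zero_iff]
    omega

open Classical in
theorem sum_schur_lower (hneg : ∀ k < 0, h k = 0) (h0 : h 0 = 1)
    (hh : ∀ k : ℤ, (k : A) * h k = h (k - 1)) {n : ℕ} {lam : YoungDiagram}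
    (hlam : lam.card = n + 1) :
    ∑ mu ∈ partitionsOf n with AddsBox mu lam, schur h mu = (n + 1 : A) * schur h lam := by
  set R := length lam with hR
  have hlast : lam.rowLen R = 0 := rowLen_eq_zero_iff.2 le_rfl
  have hadd (mu : YoungDiagram) (hl : AddsBox mu lam) :
      ∃ i, rows mu = Function.update (rows lam) i (rows lam i + -1) ∧
        mu.rowLen i + 1 = lam.rowLen i ∧ ∀ k, k ≠ i → mu.rowLen k = lam.rowLen k := by
    obtain ⟨i, hi⟩ := hl.exists_rows_eq
    refine ⟨i, by simp [hi], ?_, fun k hk => ?_⟩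
    · have := congrFun hi i
      rw [Function.update_self] at this
      simp only [rows] at this
      exact_mod_cast this.symm
    · have := congrFun hi k
      rw [Function.update_of_ne hk] at this
      simp only [rows] at this
      exact_mod_cast this.symm
  choose! e he hself hrow using hadd
  have hlt {mu} (hl : AddsBox mu lam) : e mu < R := by
    by_contra hge
    have := rowLen_eq_zero_iff.2 (not_lt.1 hge)
    have := hself mu hl
    omega
  -- Size R + 1 gives every row i < R a row below it. A row that cannot be shortened then yields two
  -- equal rows, and the extra summand i = R has a zero last row.
  have hsum := sum_jacobiTrudi_lower hh (R + 1) (rows lam)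
  rw [sum_rows (by omega), jacobiTrudi_rows hneg h0 (by omega), hlam,
    Fin.sum_univ_eq_sum_range
      (fun i => jacobiTrudi h (R + 1) (Function.update (rows lam) i (rows lam i - 1)))] at hsum
  push_cast at hsum
  rw [← hsum]
  refine Finset.sum_of_injOn e ?_ ?_ ?_ ?_
  · intro a ha b hb hab
    have ha := (Finset.mem_filter.1 ha).2
    have hb := (Finset.mem_filter.1 hb).2
    exact rows_injective (by rw [he a ha, he b hb, hab])
  · intro a ha
    have := hlt (Finset.mem_filter.1 ha).2
    exact Finset.mem_range.2 (by omega)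
  · intro i hi hni
    rw [Finset.mem_range] at hi
    by_cases hc : lam.rowLen (i + 1) < lam.rowLen i
    · obtain ⟨mu, hl, hr⟩ := exists_addsBox_lower hc
      refine absurd ⟨mu, ?_, ?_⟩ hni
      · rw [Finset.coe_filter]
        refine ⟨mem_partitionsOf.2 ?_, hl⟩
        have := hl.2
        omega
      · exact update_add_index_injective (by norm_num) ((he mu hl).symm.trans hr)
    · have hk := le_antisymm (not_lt.1 hc) (lam.rowLen_anti i (i + 1) (by omega))
      rcases (Nat.lt_succ_iff.1 hi).eq_or_lt with rfl | hiR
      · refine jacobiTrudi_eq_zero_of_last_neg hneg ?_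
        rw [Function.update_self, rows, hlast]
        norm_num
      · refine jacobiTrudi_eq_zero_of_adjacent h (k := i) (by omega) ?_
        simp [rows, hk]
  · intro mu hl
    have hl := (Finset.mem_filter.1 hl).2
    rw [sub_eq_add_neg, ← he mu hl, jacobiTrudi_rows hneg h0]
    have := hlt hl
    rw [← rowLen_eq_zero_iff, hrow mu hl _ (by omega), rowLen_eq_zero_iff]
    omega

theorem sum_numPaths_mul_schur (hneg : ∀ k < 0, h k = 0) (h0 : h 0 = 1) (n : ℕ) :
    ∑ lam ∈ partitionsOf n, (numPaths lam : A) * schur h lam = h 1 ^ n := by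
  classical
  induction n with
  | zero => simp [partitionsOf_zero, numPaths_bot, schur_bot]
  | succ n ih =>
    calc ∑ lam ∈ partitionsOf (n + 1), (numPaths lam : A) * schur h lam
        = ∑ lam ∈ partitionsOf (n + 1), ∑ mu ∈ partitionsOf n,
            if AddsBox mu lam then (numPaths mu : A) * schur h lam else 0 := by
          refine Finset.sum_congr rfl fun lam hl => ?_
          rw [numPaths_eq_sum (mem_partitionsOf.1 hl), Nat.cast_sum, Finset.sum_mul,
            Finset.sum_filter]
      _ = ∑ mu ∈ partitionsOf n, (numPaths mu : A) * (h 1 * schur h mu) := by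
          rw [Finset.sum_comm]
          refine Finset.sum_congr rfl fun mu hl => ?_
          rw [← sum_schur_raise hneg h0 (mem_partitionsOf.1 hl), Finset.mul_sum,
            Finset.sum_filter]
      _ = h 1 ^ (n + 1) := by
          rw [pow_succ', ← ih, Finset.mul_sum]
          exact Finset.sum_congr rfl fun _ _ => by ring

/-- Under `hh`, n! s_λ satisfies the same recursion over removable boxes as the number of paths. -/
theorem numPaths_eq_factorial_mul_schur (hneg : ∀ k < 0, h k = 0) (h0 : h 0 = 1)
    (hh : ∀ k : ℤ, (k : A) * h k = h (k - 1)) {n : ℕ} {lam : YoungDiagram}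
    (hlam : lam.card = n) : (numPaths lam : A) = n.factorial * schur h lam := by
  classical
  induction n generalizing lam with
  | zero => simp [eq_bot_of_card_eq_zero hlam, numPaths_bot, schur_bot]
  | succ n ih =>
    rw [numPaths_eq_sum hlam, Nat.cast_sum, Nat.factorial_succ]
    push_cast
    rw [mul_right_comm, ← sum_schur_lower hneg h0 hh hlam, Finset.sum_mul]
    refine Finset.sum_congr rfl fun mu hmu => ?_
    rw [ih (mem_partitionsOf.1 (Finset.mem_filter.1 hmu).1), mul_comm]

/-- Reversing the rows of the transposed Jacobi–Trudi matrix gives this one. The sign will occur in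
both the Wronskian and its denominator. -/
theorem det_degVec (h : ℤ → A) (lam : YoungDiagram) :
    (Matrix.of fun i j : Fin (length lam) => h (degVec lam j - (i : ℕ))).det =
      (Equiv.Perm.sign (Fin.revPerm : Equiv.Perm (Fin (length lam))) : ℤ) * schur h lam := by
  have : (Matrix.of fun i j : Fin (length lam) => h (degVec lam j - (i : ℕ))) =
      (Matrix.of fun i j : Fin (length lam) => h (rows lam i + j - i)).transpose.submatrix
        Fin.revPerm id := by
    ext i j
    simp only [Matrix.of_apply, Matrix.submatrix_apply, Matrix.transpose_apply, id, rows, degVec,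
      Fin.revPerm_apply, Fin.val_rev]
    congr 1
    have := i.2
    have := j.2
    omega
  rw [this, Matrix.det_permute, Matrix.det_transpose, schur, jacobiTrudi]

end Schur

/-! ### Wronskian and Vandermonde product as Schur functions -/

theorem degVec_injective (lam : YoungDiagram) : Function.Injective (degVec lam) := by
  refine StrictAnti.injective fun i j hij => ?_
  have h1 := lam.rowLen_anti i j hij.le
  have h2 : (i : ℕ) < j := hij
  have := j.2
  simp only [degVec]
  omega

/-- Falling factorials are monic of degree i, so they may replace the powers in a Vandermonde
determinant. -/
theorem det_descFactorial [CharZero K] {r : ℕ} (v : Fin r → ℕ) :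
    (Matrix.of fun i j : Fin r => ((v j).descFactorial i : K)).det =
      ∏ i : Fin r, ∏ j ∈ Finset.Ioi i, ((v j : K) - v i) := by
  rw [← Matrix.det_vandermonde, ← Matrix.det_transpose,
    Matrix.det_eval_matrixOfPolynomials_eq_det_vandermonde (fun i => (v i : K))
      (fun i => descPochhammer K i) (fun i => descPochhammer_natDegree K i)
      (fun i => monic_descPochhammer K i)]
  congr 1
  ext i j
  simp [descPochhammer_eval_eq_descFactorial]

theorem wr_modLaguerre [CharZero K] (α : K) (lam : YoungDiagram) :
    (wr fun i => modLaguerre α (degVec lam i)) =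
      C (∏ i, ((degVec lam i).factorial : K)) *
        ((Equiv.Perm.sign (Fin.revPerm : Equiv.Perm (Fin (length lam))) : ℤ) *
          schur (normLaguerre α) lam) := by
  rw [wr, ← det_degVec, map_prod, ← Matrix.det_mul_row]
  congr 1
  ext1 i j
  exact iterate_derivative_modLaguerre α (degVec lam j) i

theorem prod_degVec_sub [CharZero K] (lam : YoungDiagram) :
    ∏ i : Fin (length lam), ∏ j ∈ Finset.Ioi i, ((degVec lam j : K) - degVec lam i) =
      (∏ i, ((degVec lam i).factorial : K)) *
        ((Equiv.Perm.sign (Fin.revPerm : Equiv.Perm (Fin (length lam))) : ℤ) *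
          schur (invFactorial K) lam) := by
  rw [← det_descFactorial, ← det_degVec, ← Matrix.det_mul_row]
  congr 1
  ext1 i j
  exact (factorial_mul_invFactorial_sub (degVec lam j) i).symm

theorem prod_degVec_sub_ne_zero [CharZero K] (lam : YoungDiagram) :
    ∏ i : Fin (length lam), ∏ j ∈ Finset.Ioi i, ((degVec lam j : K) - degVec lam i) ≠ 0 := by
  refine Finset.prod_ne_zero_iff.2 fun i _ => Finset.prod_ne_zero_iff.2 fun j hj => ?_
  refine sub_ne_zero.2 fun h => (Finset.mem_Ioi.1 hj).ne' ?_
  exact degVec_injective lam (Nat.cast_injective h)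

theorem numPaths_eq_factorial_mul_schur_invFactorial [CharZero K] {n : ℕ} {lam : YoungDiagram}
    (hlam : lam.card = n) :
    (numPaths lam : K) = n.factorial * schur (invFactorial K) lam :=
  numPaths_eq_factorial_mul_schur (fun _ => invFactorial_of_neg) invFactorial_zero
    mul_invFactorial hlam

theorem numPaths_mul_wronskianLaguerre [CharZero K] (α : K) {n : ℕ} {lam : YoungDiagram}
    (hlam : lam.card = n) :
    C (numPaths lam : K) * wronskianLaguerre α lam =
      C (n.factorial : K) * schur (normLaguerre α) lam := by
  have hne := prod_degVec_sub_ne_zero (K := K) lam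
  rw [wronskianLaguerre, wr_modLaguerre, numPaths_eq_factorial_mul_schur_invFactorial hlam]
  rw [prod_degVec_sub] at hne ⊢
  set s : ℤ := (Equiv.Perm.sign (Fin.revPerm : Equiv.Perm (Fin (length lam))) : ℤ)
  set p := ∏ i, ((degVec lam i).factorial : K)
  set t := schur (invFactorial K) lam
  have hs : ((s : ℤ) : K[X]) = C (s : K) := by simp
  -- The denominator p s t cancels the factorials p and the sign s of the Wronskian, and the t in
  -- F_λ = n! t.
  have hcancel : (n.factorial : K) * t * ((p * (s * t))⁻¹ * p * s) = n.factorial := by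
    have hp := left_ne_zero_of_mul hne
    have hs := left_ne_zero_of_mul (right_ne_zero_of_mul hne)
    have ht := right_ne_zero_of_mul (right_ne_zero_of_mul hne)
    field_simp
  rw [hs]
  calc _ = C ((n.factorial : K) * t * ((p * (s * t))⁻¹ * p * s)) *
        schur (normLaguerre α) lam := by
        simp only [C_mul]
        ring
    _ = _ := by rw [hcancel]

end WronskianLaguerre

end

theorem mainTheorem2 {K : Type*} [Field K] [CharZero K] (α : K) (n : ℕ) :
    ∑ lam ∈ WronskianLaguerre.partitionsOf n,
        C ((WronskianLaguerre.numPaths lam : K) ^ 2 / (n.factorial : K)) *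
          WronskianLaguerre.wronskianLaguerre α lam
      = (X + C α) ^ n := by
  rw [← WronskianLaguerre.normLaguerre_one, ← WronskianLaguerre.sum_numPaths_mul_schur
    (fun _ => WronskianLaguerre.normLaguerre_of_neg α) (WronskianLaguerre.normLaguerre_zero α)]
  -- Termwise: one factor F_λ turns l_λ into n! s_λ(h), the n! cancels, and the other F_λ remains.
  refine Finset.sum_congr rfl fun lam hlam => ?_
  have hn : (n.factorial : K) ≠ 0 := by exact_mod_cast n.factorial_ne_zero
  rw [sq, mul_div_right_comm, C_mul, mul_assoc,
    WronskianLaguerre.numPaths_mul_wronskianLaguerre α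
      (WronskianLaguerre.mem_partitionsOf.1 hlam), ← mul_assoc, ← C_mul, div_mul_cancel₀ _ hn,
    map_natCast]
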